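/- Let $n,p,d\ge 1$, let $\sigma:\mathbb R\to\mathbb R$ be differentiable and $L$-Lipschitz with $|\sigma'|\le M_D$, and let $a\in\mathbb R^p$. Let $(x_i,y_i)\in\mathbb R^d\times\{+1,-1\}$, $i=1,\dots,n$, be arbitrary data with $\|x_i\|_2\le B_x$. For $W\in\mathbb R^{p\times d}$ let $f(x;W)=a^\top\sigma(Wx)$ ($\sigma$ applied elementwise), and for $\lambda>0$ let $$\tilde L(W)=\frac1n\sum_{i=1}^n\log\left(1+e^{-y_i f(x_i;W)}\right)+\frac\lambda2\|W\|_F^2 .$$ Set $\lambda_c=\tfrac12 M_D L B_x^2\|a\|_2^2$. 1. If $\lambda>\lambda_c$, then for every $s>0$ the function $e^{-2\tilde L/s}$ is integrable and the Gibbs probability measure $\mu_s=\frac1{Z_s}e^{-2\tilde L(W)/s}\,dW$ satisfies a Poincaré-type inequality: there is $\lambda_s>0$ such that $\mathrm{Var}_{\mu_s}[h]\le\frac{s}{2\lambda_s}\,\mathbb E_{\mu_s}[\|\nabla h\|^2]$ for all $h\in C_c^\infty(\mathbb R^{p\times d})$. 2. If in addition $\sigma$ is $C^\infty$ with $|\sigma''|\le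 M_D'$ ($\sigma$ may be unbounded), then for $\lambda>\lambda_c$ the loss $\tilde L$ is a Villani function, i.e. $\tilde L$ is $C^\infty$, $\tilde L(W)\to+\infty$ as $\|W\|_F\to\infty$, and for every $s>0$ one has $\int e^{-2\tilde L/s}\,dW<\infty$ and $-\Delta\tilde L(W)+\frac1s\|\nabla\tilde L(W)\|^2\to+\infty$ as $\|W\|_F\to\infty$. 3. If moreover $|\sigma|\le B_\sigma$, then for every $\lambda>0$ the gradient of $\tilde L$ is Lipschitz with some constant $\mathrm{gLip}(\tilde L)>0$ such that, with $c=\sigma(0)\in\mathbb R^p$ the vector all of whose entries are the number $\sigma(0)$, $$\mathrm{gLip}(\tilde L)\le\sqrt p\left(\frac{\sqrt p\,\|a\|_2^2M_D^2B_x^2}{4}+\frac{2+\|c\|_2+\|a\|_2B_\sigma}{4}\,M_D'\,B_x^2\,\|a\|_2\,p+\lambda\right).$$ -/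

import Mathlib

open MeasureTheory Filter
open scoped ContDiff NNReal

noncomputable section

/-! ### Villani functions, Gibbs measures, gradient-Lipschitz functions -/

/-- A confining function: `f` is smooth, tends to infinity at infinity, and `exp (-2 f / s)` is
Lebesgue-integrable for every `s > 0`. -/
structure IsConfining {ι : Type*} [Fintype ι] (f : EuclideanSpace ℝ ι → ℝ) : Prop where
  contDiff : ContDiff ℝ ∞ f
  tendsto_atTop : Tendsto f (Bornology.cobounded (EuclideanSpace ℝ ι)) atTop
  integrable : ∀ s : ℝ, 0 < s → Integrable (fun x => Real.exp (-2 * f x / s)) volume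

/-- A Villani function: a confining function such that, for every `s > 0`,
`-Δ f + ‖∇ f‖ ^ 2 / s` tends to infinity at infinity. -/
structure IsVillani {ι : Type*} [Fintype ι] (f : EuclideanSpace ℝ ι → ℝ) : Prop
    extends IsConfining f where
  tendsto_potential : ∀ s : ℝ, 0 < s →
    Tendsto (fun x => -(Laplacian.laplacian f x) + 1 / s * ‖gradient f x‖ ^ 2)
      (Bornology.cobounded (EuclideanSpace ℝ ι)) atTop

/-- The Gibbs measure: density `exp (-2 f / s) / Z` with respect to Lebesgue measure, where
`Z = ∫ exp (-2 f / s)`. -/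
def gibbsMeasure {ι : Type*} [Fintype ι] (f : EuclideanSpace ℝ ι → ℝ) (s : ℝ) :
    Measure (EuclideanSpace ℝ ι) :=
  volume.tilted (fun x => -2 * f x / s)

/-- The Gibbs measure of `f` at `s` is a well-defined probability measure and it satisfies the
Poincaré-type inequality with constant `lam`:
`Var[h] ≤ s / (2 * lam) * E[‖∇ h‖ ^ 2]` for all smooth compactly supported `h`. -/
structure GibbsPoincare {ι : Type*} [Fintype ι] (f : EuclideanSpace ℝ ι → ℝ) (s lam : ℝ) :
    Prop where
  integrable : Integrable (fun x => Real.exp (-2 * f x / s)) volume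
  isProbabilityMeasure : IsProbabilityMeasure (gibbsMeasure f s)
  variance_le : ∀ h : EuclideanSpace ℝ ι → ℝ, ContDiff ℝ ∞ h → HasCompactSupport h →
    ProbabilityTheory.variance h (gibbsMeasure f s)
      ≤ s / (2 * lam) * ∫ x, ‖gradient h x‖ ^ 2 ∂(gibbsMeasure f s)

/-- `f` is `K`-smooth: differentiable with `K`-Lipschitz gradient. -/
def IsGradLipschitz {ι : Type*} [Fintype ι] (K : ℝ≥0) (f : EuclideanSpace ℝ ι → ℝ) : Prop :=
  Differentiable ℝ f ∧ LipschitzWith K (gradient f)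

/-! ### Depth-2 nets and the regularized logistic loss -/

/-- The space `ℝ^{p × d}` of weight matrices; its Euclidean norm is the Frobenius norm. -/
abbrev Weights (p d : ℕ) : Type := EuclideanSpace ℝ (Fin p × Fin d)

/-- A point of the weight space as a `p × d` matrix. -/
def Weights.toMatrix {p d : ℕ} (W : Weights p d) : Matrix (Fin p) (Fin d) ℝ :=
  Matrix.of fun j k => W (j, k)

/-- The net `x ↦ aᵀ σ(W x)`, with `σ` applied elementwise. -/
def net {p d : ℕ} (σ : ℝ → ℝ) (a : EuclideanSpace ℝ (Fin p)) (W : Weights p d)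
    (x : EuclideanSpace ℝ (Fin d)) : ℝ :=
  ∑ j, a j * σ ((W.toMatrix.mulVec x) j)

/-- The regularized logistic empirical risk
`1/n ∑ i, log (1 + exp (-y i * f (x i))) + lam / 2 * ‖W‖_F ^ 2`. -/
def logisticLoss {n p d : ℕ} (σ : ℝ → ℝ) (a : EuclideanSpace ℝ (Fin p))
    (x : Fin n → EuclideanSpace ℝ (Fin d)) (y : Fin n → ℝ) (lam : ℝ) (W : Weights p d) : ℝ :=
  1 / (n : ℝ) * ∑ i, Real.log (1 + Real.exp (-(y i) * net σ a W (x i))) + lam / 2 * ‖W‖ ^ 2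

/-- The vector `c = σ(0) ∈ ℝ^p`, the value of the elementwise activation at the zero vector. -/
def activationAtZero (σ : ℝ → ℝ) (p : ℕ) : EuclideanSpace ℝ (Fin p) :=
  WithLp.toLp 2 fun _ => σ 0

/-- The critical regularization `M_D * L * B_x ^ 2 * ‖a‖ ^ 2 / 2`. -/
def criticalLambda {p : ℕ} (M_D L B_x : ℝ) (a : EuclideanSpace ℝ (Fin p)) : ℝ :=
  M_D * L * B_x ^ 2 * ‖a‖ ^ 2 / 2

end

/-! Write the loss as `g + lam / 2 * ‖W‖ ^ 2` with `g` the logistic risk. Since the sigmoid lies in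
`[0, 1]` and `σ'` is bounded, `g` is nonnegative with bounded derivative. Since `criticalLambda` is
nonnegative, exceeding it makes `lam` positive, and positivity is what the argument needs.

Poincaré: `g` need not be convex or twice differentiable, so a Lyapunov argument is used
(`exists_weighted_poincare`). Integrating the radial field by parts against the weight controls the
mass of `u ^ 2` by the gradient energy plus the mass in a fixed ball (`integral_sq_mul_exp_le`). On
the ball the density is bounded above and below, and Poincaré for Lebesgue measure applies
(`exists_lintegral_closedBall_sq_sub_le`).

Villani: a bound on `σ''` makes the gradient Lipschitz, so the Laplacian is bounded above, while the
gradient grows linearly (`isVillani_add_sq_norm`).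

Gradient-Lipschitz constant: the product rule for sigmoid times net derivative
(`norm_sampleDeriv_sub_le`), with the sigmoid bounded through the size of the net. -/

/-! ### Poincaré inequality on a ball for Lebesgue measure. -/

section LocalPoincare

variable {E : Type*} [NormedAddCommGroup E] [InnerProductSpace ℝ E] [FiniteDimensional ℝ E]
  [MeasurableSpace E] [BorelSpace E]

open Module in
theorem lintegral_comp_smul_add {φ : E → ENNReal} (hφ : Measurable φ) {r : ℝ} (hr : 0 < r) (y : E) :
    ∫⁻ x, φ (r • x + y) = ENNReal.ofReal (r ^ finrank ℝ E)⁻¹ * ∫⁻ x, φ x := by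
  have h1 : ∫⁻ x, φ (r • x + y) = ∫⁻ z, φ (z + y) ∂(Measure.map (r • ·) (volume : Measure E)) := by
    rw [lintegral_map (by fun_prop) (by fun_prop)]
  rw [h1, Measure.map_addHaar_smul _ hr.ne', lintegral_smul_measure, lintegral_add_right_eq_self,
    abs_of_pos (by positivity), smul_eq_mul]

open Module in
theorem lintegral_comp_smul_add_le {φ : E → ENNReal} (hφ : Measurable φ) {r : ℝ}
    (hr : 1 / 2 ≤ r) (y : E) :
    ∫⁻ x, φ (r • x + y) ≤ 2 ^ finrank ℝ E * ∫⁻ x, φ x := by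
  rw [lintegral_comp_smul_add hφ (by linarith)]
  gcongr
  have h2 : (2 : ENNReal) ^ finrank ℝ E = ENNReal.ofReal (2 ^ finrank ℝ E) := by
    rw [ENNReal.ofReal_pow (by norm_num)]; simp
  rw [h2, ← inv_pow]
  gcongr
  rw [inv_le_comm₀ (by linarith) (by norm_num)]
  linarith

/-- Jensen on the unit interval: the variance of `f` about its mean is nonnegative. -/
theorem sq_intervalIntegral_le {f : ℝ → ℝ} (hf : Continuous f) :
    (∫ t in (0 : ℝ)..1, f t) ^ 2 ≤ ∫ t in (0 : ℝ)..1, f t ^ 2 := by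
  set c := ∫ t in (0 : ℝ)..1, f t with hc
  have h0 : 0 ≤ ∫ t in (0 : ℝ)..1, (f t - c) ^ 2 :=
    intervalIntegral.integral_nonneg (by norm_num) fun _ _ => sq_nonneg _
  have h1 : ∫ t in (0 : ℝ)..1, (f t - c) ^ 2
      = (∫ t in (0 : ℝ)..1, f t ^ 2) - 2 * c * c + c ^ 2 := by
    have : ∀ t, (f t - c) ^ 2 = f t ^ 2 - 2 * c * f t + c ^ 2 := fun t => by ring
    simp_rw [this]
    rw [intervalIntegral.integral_add, intervalIntegral.integral_sub,
      intervalIntegral.integral_const_mul, ← hc]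
    · simp
    all_goals exact Continuous.intervalIntegrable (by fun_prop) _ _
  nlinarith

/-- Fundamental theorem of calculus along the segment from `y` to `x`, then Jensen. Stating it in
`ENNReal` lets the later exchanges of integrals avoid integrability conditions. -/
theorem sq_sub_le_lintegral_segment {h : E → ℝ} (hh : ContDiff ℝ 1 h) (x y : E) :
    ENNReal.ofReal ((h x - h y) ^ 2) ≤ ENNReal.ofReal (‖x - y‖ ^ 2) *
      ∫⁻ t in Set.Ioc (0 : ℝ) 1, ENNReal.ofReal (‖fderiv ℝ h (t • x + (1 - t) • y)‖ ^ 2) := by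
  have hc : Continuous (fderiv ℝ h) := hh.continuous_fderiv (by norm_num)
  set γ : ℝ → E := fun t => t • x + (1 - t) • y with hγ
  have hγc : Continuous γ := by fun_prop
  have hγd : ∀ t, HasDerivAt γ (x - y) t := fun t => by
    have h1 : HasDerivAt (fun t : ℝ => t • x) ((1 : ℝ) • x) t := (hasDerivAt_id t).smul_const x
    have h2 : HasDerivAt (fun t : ℝ => (1 - t) • y) ((-1 : ℝ) • y) t :=
      ((hasDerivAt_id t).const_sub 1).smul_const y
    convert! h1.add h2 using 1
    simp [sub_eq_add_neg]
  have hd : ∀ t, HasDerivAt (fun t => h (γ t)) (fderiv ℝ h (γ t) (x - y)) t := fun t =>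
    ((hh.differentiable (by norm_num)) (γ t)).hasFDerivAt.comp_hasDerivAt t (hγd t)
  have hc' : Continuous fun t => fderiv ℝ h (γ t) (x - y) := by fun_prop
  have hftc : ∫ t in (0 : ℝ)..1, fderiv ℝ h (γ t) (x - y) = h x - h y := by
    rw [intervalIntegral.integral_eq_sub_of_hasDerivAt (fun t _ => hd t)
      (hc'.intervalIntegrable _ _)]
    simp [hγ]
  rw [← lintegral_const_mul _ (by fun_prop)]
  simp_rw [← ENNReal.ofReal_mul (sq_nonneg ‖x - y‖)]
  rw [← ofReal_integral_eq_lintegral_ofReal]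
  · apply ENNReal.ofReal_le_ofReal
    rw [← intervalIntegral.integral_of_le (by norm_num), ← hftc]
    refine (sq_intervalIntegral_le hc').trans ?_
    refine intervalIntegral.integral_mono_on (by norm_num)
      (Continuous.intervalIntegrable (by fun_prop) _ _)
      (Continuous.intervalIntegrable (by fun_prop) _ _) fun t _ => ?_
    rw [← mul_pow, ← sq_abs]
    gcongr
    rw [mul_comm]
    exact (fderiv ℝ h (γ t)).le_opNorm _
  · exact (Continuous.integrableOn_Icc (by fun_prop)).mono_set Set.Ioc_subset_Icc_self
  · exact ae_of_all _ fun t => by positivity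

open Module in
theorem lintegral_lintegral_sq_sub_le {h : E → ℝ} (hh : ContDiff ℝ 1 h) {s : Set E}
    (hs : Convex ℝ s) (hsm : MeasurableSet s) {D : ℝ} (hD : ∀ x ∈ s, ∀ y ∈ s, ‖x - y‖ ≤ D) :
    ∫⁻ y in s, ∫⁻ x in s, ENNReal.ofReal ((h x - h y) ^ 2) ≤
      ENNReal.ofReal (D ^ 2) * (2 ^ finrank ℝ E * volume s *
        ∫⁻ x in s, ENNReal.ofReal (‖fderiv ℝ h x‖ ^ 2)) := by
  have hc : Continuous (fderiv ℝ h) := hh.continuous_fderiv (by norm_num)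
  -- Extension by zero: after an affine substitution the integral can be enlarged to the whole space
  -- at no cost, and convexity keeps the segments inside `s`.
  set φ : E → ENNReal := s.indicator fun x => ENNReal.ofReal (‖fderiv ℝ h x‖ ^ 2) with hφ
  have hφm : Measurable φ := Measurable.indicator (by fun_prop) hsm
  have hφi : ∫⁻ x, φ x = ∫⁻ x in s, ENNReal.ofReal (‖fderiv ℝ h x‖ ^ 2) :=
    lintegral_indicator hsm _
  have key : ∀ t ∈ Set.Ioc (0 : ℝ) 1,
      ∫⁻ y in s, ∫⁻ x in s, φ (t • x + (1 - t) • y) ≤ 2 ^ finrank ℝ E * volume s * ∫⁻ x, φ x := by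
    intro t ht
    -- One of the coefficients `t`, `1 - t` is at least `1 / 2`. Substituting in the corresponding
    -- variable keeps the Jacobian factor at most `2 ^ finrank`, uniformly in `t`.
    by_cases h2 : 1 / 2 ≤ t
    · calc ∫⁻ y in s, ∫⁻ x in s, φ (t • x + (1 - t) • y)
          ≤ ∫⁻ y in s, 2 ^ finrank ℝ E * ∫⁻ x, φ x := by
            refine lintegral_mono fun y => ?_
            exact (setLIntegral_le_lintegral _ _).trans (lintegral_comp_smul_add_le hφm h2 _)
        _ = _ := by rw [setLIntegral_const]; ring
    · rw [lintegral_lintegral_swap (by fun_prop)]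
      calc ∫⁻ x in s, ∫⁻ y in s, φ (t • x + (1 - t) • y)
          ≤ ∫⁻ x in s, 2 ^ finrank ℝ E * ∫⁻ x, φ x := by
            refine lintegral_mono fun x => ?_
            simp_rw [add_comm (t • x)]
            exact (setLIntegral_le_lintegral _ _).trans
              (lintegral_comp_smul_add_le hφm (by linarith) _)
        _ = _ := by rw [setLIntegral_const]; ring
  have pt : ∀ y ∈ s, ∀ x ∈ s, ENNReal.ofReal ((h x - h y) ^ 2) ≤
      ENNReal.ofReal (D ^ 2) * ∫⁻ t in Set.Ioc (0 : ℝ) 1, φ (t • x + (1 - t) • y) := by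
    intro y hy x hx
    refine (sq_sub_le_lintegral_segment hh x y).trans ?_
    gcongr ?_ * ?_
    · apply ENNReal.ofReal_le_ofReal
      have := hD x hx y hy
      gcongr
    · refine setLIntegral_mono' measurableSet_Ioc fun t ht => ?_
      rw [hφ, Set.indicator_of_mem]
      exact hs hx hy ht.1.le (by linarith [ht.2]) (by ring)
  calc ∫⁻ y in s, ∫⁻ x in s, ENNReal.ofReal ((h x - h y) ^ 2)
      ≤ ∫⁻ y in s, ∫⁻ x in s, ENNReal.ofReal (D ^ 2) *
          ∫⁻ t in Set.Ioc (0 : ℝ) 1, φ (t • x + (1 - t) • y) :=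
        setLIntegral_mono' hsm fun y hy => setLIntegral_mono' hsm fun x hx => pt y hy x hx
    _ = ENNReal.ofReal (D ^ 2) * ∫⁻ y in s, ∫⁻ x in s,
          ∫⁻ t in Set.Ioc (0 : ℝ) 1, φ (t • x + (1 - t) • y) := by
        simp_rw [lintegral_const_mul' _ _ ENNReal.ofReal_ne_top]
    _ = ENNReal.ofReal (D ^ 2) * ∫⁻ t in Set.Ioc (0 : ℝ) 1, ∫⁻ y in s, ∫⁻ x in s,
          φ (t • x + (1 - t) • y) := by
        congr 1
        have hin : ∀ y, ∫⁻ x in s, ∫⁻ t in Set.Ioc (0 : ℝ) 1, φ (t • x + (1 - t) • y)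
            = ∫⁻ t in Set.Ioc (0 : ℝ) 1, ∫⁻ x in s, φ (t • x + (1 - t) • y) := fun y =>
          lintegral_lintegral_swap (by fun_prop)
        simp_rw [hin]
        refine lintegral_lintegral_swap ?_
        refine Measurable.aemeasurable ?_
        exact Measurable.lintegral_prod_right'
          (f := fun q : (E × ℝ) × E => φ (q.1.2 • q.2 + (1 - q.1.2) • q.1.1)) (by fun_prop)
    _ ≤ ENNReal.ofReal (D ^ 2) * ∫⁻ t in Set.Ioc (0 : ℝ) 1,
          2 ^ finrank ℝ E * volume s * ∫⁻ x, φ x := by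
        exact mul_le_mul' le_rfl (setLIntegral_mono' measurableSet_Ioc key)
    _ = _ := by simp [hφi]

open Module in
/-- Poincaré's inequality on a ball, with the mean replaced by a value of the function. -/
theorem exists_lintegral_closedBall_sq_sub_le {R : ℝ} (hR : 0 < R) {h : E → ℝ}
    (hh : ContDiff ℝ 1 h) :
    ∃ m : ℝ, ∫⁻ x in Metric.closedBall (0 : E) R, ENNReal.ofReal ((h x - m) ^ 2) ≤
      ENNReal.ofReal ((2 * R) ^ 2 * 2 ^ finrank ℝ E) *
        ∫⁻ x in Metric.closedBall (0 : E) R, ENNReal.ofReal (‖fderiv ℝ h x‖ ^ 2) := by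
  set B := Metric.closedBall (0 : E) R with hB
  have hc : Continuous h := hh.continuous
  have hv0 : volume B ≠ 0 := (Metric.measure_closedBall_pos _ _ hR).ne'
  have hvt : volume B ≠ ⊤ := measure_closedBall_lt_top.ne
  have hmeas : Measurable fun y => ∫⁻ x in B, ENNReal.ofReal ((h x - h y) ^ 2) :=
    Measurable.lintegral_prod_right' (f := fun q : E × E => ENNReal.ofReal ((h q.2 - h q.1) ^ 2))
      (by fun_prop)
  -- Some `y` does no worse than the average over the ball, so `h y` can serve as the centring
  -- constant. Dividing by the volume cancels the volume factor of the double integral.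
  obtain ⟨y, -, hy⟩ := exists_le_setLAverage hv0 hvt hmeas.aemeasurable
  refine ⟨h y, hy.trans ?_⟩
  rw [setLAverage_eq]
  apply ENNReal.div_le_of_le_mul
  refine (lintegral_lintegral_sq_sub_le hh (convex_closedBall _ _) measurableSet_closedBall
    (D := 2 * R) fun x hx z hz => ?_).trans (le_of_eq ?_)
  · have h1 := mem_closedBall_zero_iff.1 hx
    have h2 := mem_closedBall_zero_iff.1 hz
    linarith [norm_sub_le x z]
  · rw [ENNReal.ofReal_mul (by positivity), ENNReal.ofReal_pow (p := 2) (by norm_num)]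
    simp only [ENNReal.ofReal_ofNat]
    ring

open Module in
theorem exists_integral_closedBall_sq_sub_le {R : ℝ} (hR : 0 < R) {h : E → ℝ}
    (hh : ContDiff ℝ 1 h) :
    ∃ m : ℝ, ∫ x in Metric.closedBall (0 : E) R, (h x - m) ^ 2 ≤
      ((2 * R) ^ 2 * 2 ^ finrank ℝ E) *
        ∫ x in Metric.closedBall (0 : E) R, ‖fderiv ℝ h x‖ ^ 2 := by
  obtain ⟨m, hm⟩ := exists_lintegral_closedBall_sq_sub_le hR hh
  have hc : Continuous h := hh.continuous
  have hc' : Continuous (fderiv ℝ h) := hh.continuous_fderiv (by norm_num)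
  have hK : IsCompact (Metric.closedBall (0 : E) R) := isCompact_closedBall _ _
  refine ⟨m, ?_⟩
  rw [← ofReal_integral_eq_lintegral_ofReal
      (ContinuousOn.integrableOn_compact hK (by fun_prop)) (ae_of_all _ fun x => sq_nonneg _),
    ← ofReal_integral_eq_lintegral_ofReal
      (ContinuousOn.integrableOn_compact hK (by fun_prop)) (ae_of_all _ fun x => sq_nonneg _),
    ← ENNReal.ofReal_mul (by positivity)] at hm
  refine (ENNReal.ofReal_le_ofReal_iff ?_).1 hm
  exact mul_nonneg (by positivity) (integral_nonneg fun x => sq_nonneg _)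

end LocalPoincare

/-! ### Poincaré inequality for a Gaussian weight perturbed by a function with bounded derivative.
-/

section WeightedPoincare

variable {E : Type*} [NormedAddCommGroup E] [InnerProductSpace ℝ E] [FiniteDimensional ℝ E]
  [MeasurableSpace E] [BorelSpace E]

theorem integrable_exp_neg_mul_sq_norm {b : ℝ} (hb : 0 < b) :
    Integrable fun x : E => Real.exp (-(b * ‖x‖ ^ 2)) := by
  have h := (GaussianFourier.integrable_cexp_neg_mul_sq_norm_add (V := E) (b := (b : ℂ))
    (by simpa using hb) 0 0).norm
  refine h.congr (ae_of_all _ fun x => ?_)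
  simp only [Complex.norm_exp]
  congr 1
  simp [← Complex.ofReal_pow, ← Complex.ofReal_mul]

/-- Half of the Gaussian decay absorbs the quadratic factor, by `t + 1 ≤ exp t`; the other half is
integrable. -/
theorem integrable_mul_exp_neg_of_quadratic_growth {c : ℝ} (hc : 0 < c) {V : E → ℝ}
    (hV : Measurable V) (hVc : ∀ x, c * ‖x‖ ^ 2 ≤ V x) {f : E → ℝ} (hf : Measurable f) {A : ℝ}
    (hA : ∀ x, |f x| ≤ A * (1 + ‖x‖ ^ 2)) :
    Integrable fun x => f x * Real.exp (-V x) := by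
  have hA0 : 0 ≤ A := by simpa using (abs_nonneg _).trans (hA 0)
  refine ((integrable_exp_neg_mul_sq_norm (E := E) (half_pos hc)).const_mul
    (A * (1 + 2 / c))).mono' (by fun_prop) (ae_of_all _ fun x => ?_)
  rw [norm_mul, Real.norm_eq_abs, Real.norm_of_nonneg (Real.exp_pos _).le]
  set r := ‖x‖ ^ 2 with hr
  have hr0 : 0 ≤ r := by positivity
  have h1 : c / 2 * r + 1 ≤ Real.exp (c / 2 * r) := Real.add_one_le_exp _
  have h2 : 1 + r ≤ (1 + 2 / c) * Real.exp (c / 2 * r) := by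
    have h3 : r ≤ 2 / c * Real.exp (c / 2 * r) := by
      rw [div_mul_eq_mul_div, le_div_iff₀ hc]; nlinarith
    have h4 : 0 ≤ c / 2 * r := by positivity
    linarith
  calc |f x| * Real.exp (-V x) ≤ (A * ((1 + 2 / c) * Real.exp (c / 2 * r))) * Real.exp (-(c * r)) :=
        mul_le_mul ((hA x).trans (by gcongr)) (Real.exp_le_exp.2 (by linarith [hVc x]))
          (Real.exp_pos _).le (by positivity)
    _ = A * (1 + 2 / c) * (Real.exp (c / 2 * r) * Real.exp (-(c * r))) := by ring
    _ = A * (1 + 2 / c) * Real.exp (-(c / 2 * r)) := by rw [← Real.exp_add]; ring_nf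

open Module in
/-- Integration by parts of the radial field `x` against `u ^ 2 * exp (-V)`. -/
theorem integral_sq_mul_fderiv_apply_self {c : ℝ} (hc : 0 < c) {V : E → ℝ}
    (hV : Differentiable ℝ V) (hVc : ∀ x, c * ‖x‖ ^ 2 ≤ V x)
    {K : ℝ} (hV' : ∀ x, ‖fderiv ℝ V x‖ ≤ K * (1 + ‖x‖))
    {u : E → ℝ} (hu : ContDiff ℝ 1 u) {A : ℝ} (hA : ∀ x, |u x| ≤ A)
    (hA' : ∀ x, ‖fderiv ℝ u x‖ ≤ A) :
    ∫ x, (u x ^ 2 * fderiv ℝ V x x) * Real.exp (-V x)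
      = ∫ x, (2 * u x * fderiv ℝ u x x + finrank ℝ E * u x ^ 2) * Real.exp (-V x) := by
  have hA0 : 0 ≤ A := (abs_nonneg _).trans (hA 0)
  have hK0 : 0 ≤ K := by simpa using (norm_nonneg _).trans (hV' 0)
  have hVm : Measurable V := hV.continuous.measurable
  have hum : Measurable u := hu.continuous.measurable
  have hud : Differentiable ℝ u := hu.differentiable (by norm_num)
  have hr : ∀ x : E, ‖x‖ ≤ 1 + ‖x‖ ^ 2 := fun x => by nlinarith [sq_nonneg (‖x‖ - 1)]
  have hu2 : ∀ x, u x ^ 2 ≤ A ^ 2 := fun x => sq_le_sq' (abs_le.1 (hA x)).1 (abs_le.1 (hA x)).2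
  -- The radial field is split into its components `⟪b i, x⟫ b i`. Each has divergence one, and the
  -- sum over `i` produces the term `finrank * u ^ 2`.
  let b := stdOrthonormalBasis ℝ E
  have hbn : ∀ i, ‖b i‖ = 1 := fun i => b.orthonormal.1 i
  have hbx : ∀ i x, |inner ℝ (b i) x| ≤ ‖x‖ := fun i x => by
    simpa [hbn] using abs_real_inner_le_norm (b i) x
  have hsum : ∀ (l : E →L[ℝ] ℝ) x, ∑ i, inner ℝ (b i) x * l (b i) = l x := fun l x => by
    conv_rhs => rw [← b.sum_repr' x, map_sum]
    simp
  have hw' : ∀ x v, fderiv ℝ (fun x => Real.exp (-V x)) x v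
      = -(fderiv ℝ V x v * Real.exp (-V x)) := fun x v => by
    have := ((hV x).hasFDerivAt.neg.exp).fderiv
    rw [show (fun x => Real.exp (-V x)) = fun x => Real.exp ((-V) x) from rfl, this]
    simp [mul_comm]
  have hf' : ∀ i x, fderiv ℝ (fun x => u x ^ 2 * inner ℝ (b i) x) x (b i)
      = 2 * u x * (inner ℝ (b i) x * fderiv ℝ u x (b i)) + u x ^ 2 := fun i x => by
    have h1 : HasFDerivAt (fun x : E => inner ℝ (b i) x) (innerSL ℝ (b i)) x :=
      (innerSL ℝ (b i)).hasFDerivAt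
    have h2 := ((hud x).hasFDerivAt.pow 2).mul h1
    rw [show (fun x => u x ^ 2 * inner ℝ (b i) x) = ((fun x => u x ^ 2) * fun x => inner ℝ (b i) x)
        from rfl,
      h2.fderiv]
    simp [hbn]
    ring
  have hint1 : ∀ i, Integrable fun x =>
      (u x ^ 2 * (inner ℝ (b i) x * fderiv ℝ V x (b i))) * Real.exp (-V x) := fun i => by
    refine integrable_mul_exp_neg_of_quadratic_growth hc hVm hVc (A := A ^ 2 * (2 * K))
      (by fun_prop) fun x => ?_
    have h1 : |fderiv ℝ V x (b i)| ≤ K * (1 + ‖x‖) := by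
      simpa [hbn] using (fderiv ℝ V x).le_of_opNorm_le (hV' x) (b i)
    rw [abs_mul, abs_mul, abs_of_nonneg (sq_nonneg (u x))]
    calc u x ^ 2 * (|inner ℝ (b i) x| * |fderiv ℝ V x (b i)|)
        ≤ A ^ 2 * (‖x‖ * (K * (1 + ‖x‖))) := by
          have := hbx i x
          have h2 := hu2 x
          have h0 := sq_nonneg (u x)
          generalize u x ^ 2 = q at h2 h0 ⊢
          gcongr
      _ ≤ A ^ 2 * (K * (2 * (1 + ‖x‖ ^ 2))) := by
          have : ‖x‖ * (1 + ‖x‖) ≤ 2 * (1 + ‖x‖ ^ 2) := by nlinarith [hr x]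
          calc _ = A ^ 2 * (K * (‖x‖ * (1 + ‖x‖))) := by ring
            _ ≤ _ := by gcongr
      _ = _ := by ring
  have hint2 : ∀ i, Integrable fun x =>
      (2 * u x * (inner ℝ (b i) x * fderiv ℝ u x (b i)) + u x ^ 2) * Real.exp (-V x) := fun i => by
    refine integrable_mul_exp_neg_of_quadratic_growth hc hVm hVc (A := 3 * A ^ 2)
      (by fun_prop) fun x => ?_
    have h1 : |fderiv ℝ u x (b i)| ≤ A := by
      simpa [hbn] using (fderiv ℝ u x).le_of_opNorm_le (hA' x) (b i)
    refine (abs_add_le _ _).trans ?_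
    rw [abs_mul, abs_mul, abs_mul, abs_of_nonneg (sq_nonneg (u x)), abs_two]
    calc 2 * |u x| * (|inner ℝ (b i) x| * |fderiv ℝ u x (b i)|) + u x ^ 2
        ≤ 2 * A * ((1 + ‖x‖ ^ 2) * A) + A ^ 2 := by
          have := (hbx i x).trans (hr x)
          have := hA x
          have h2 := hu2 x
          generalize u x ^ 2 = q at h2 ⊢
          gcongr
      _ ≤ _ := by nlinarith [mul_nonneg (sq_nonneg A) (sq_nonneg ‖x‖)]
  have hint3 : ∀ i, Integrable fun x => (u x ^ 2 * inner ℝ (b i) x) * Real.exp (-V x) := fun i => by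
    refine integrable_mul_exp_neg_of_quadratic_growth hc hVm hVc (A := A ^ 2)
      (by fun_prop) fun x => ?_
    rw [abs_mul, abs_of_nonneg (sq_nonneg (u x))]
    have := (hbx i x).trans (hr x)
    have h2 := hu2 x
    have h0 := sq_nonneg (u x)
    generalize u x ^ 2 = q at h2 h0 ⊢
    gcongr
  have key : ∀ i, ∫ x, (u x ^ 2 * (inner ℝ (b i) x * fderiv ℝ V x (b i))) * Real.exp (-V x)
      = ∫ x, (2 * u x * (inner ℝ (b i) x * fderiv ℝ u x (b i)) + u x ^ 2) * Real.exp (-V x) := by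
    intro i
    have h := integral_mul_fderiv_eq_neg_fderiv_mul_of_integrable (μ := (volume : Measure E))
      (f := fun x => u x ^ 2 * inner ℝ (b i) x) (g := fun x => Real.exp (-V x)) (v := b i)
      (by simpa only [hf'] using hint2 i)
      (by
        simp only [hw']
        refine (hint1 i).neg.congr (ae_of_all _ fun x => ?_)
        simp only [Pi.neg_apply]; ring)
      (hint3 i)
      (fun x _ => ((hud x).pow 2).mul (innerSL ℝ (b i)).differentiableAt)
      (fun x _ => (hV x).neg.exp)
    simp only [hf', hw'] at h
    rw [← neg_inj, ← h, ← integral_neg]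
    congr 1 with x
    ring
  calc ∫ x, (u x ^ 2 * fderiv ℝ V x x) * Real.exp (-V x)
      = ∫ x, ∑ i, (u x ^ 2 * (inner ℝ (b i) x * fderiv ℝ V x (b i))) * Real.exp (-V x) := by
        congr 1 with x
        rw [← Finset.sum_mul, ← Finset.mul_sum, hsum]
    _ = ∫ x, ∑ i, (2 * u x * (inner ℝ (b i) x * fderiv ℝ u x (b i)) + u x ^ 2)
          * Real.exp (-V x) := by
        rw [integral_finsetSum _ fun i _ => hint1 i, integral_finsetSum _ fun i _ => hint2 i]
        exact Finset.sum_congr rfl fun i _ => key i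
    _ = _ := by
        congr 1 with x
        rw [← Finset.sum_mul, Finset.sum_add_distrib, ← Finset.mul_sum, hsum]
        simp

/-- The pointwise inequality behind the Lyapunov estimate: `ρ = ‖x‖`, `q = Du x`, `e = ‖Du‖`,
`v = DV x`, and `l` is the localization of `y ^ 2 * w` to the ball of radius `R`. -/
theorem sq_mul_le_of_radial_growth {c K N R ρ y w q e v l : ℝ} (hc : 0 < c) (hK : 0 ≤ K)
    (hN : 0 ≤ N) (hR : 1 ≤ R) (hcR : c * R = c + (K + N + 1)) (hρ : 0 ≤ ρ) (hw : 0 ≤ w)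
    (hq : |q| ≤ e * ρ) (hv : 2 * c * ρ ^ 2 - K * ρ ≤ v)
    (hin : ρ ≤ R → l = y ^ 2 * w) (hout : R < ρ → l = 0) :
    y ^ 2 * w ≤ (y ^ 2 * v) * w - (2 * y * q + N * y ^ 2) * w
      + (1 / c * (e ^ 2 * w) + (1 + K * R + N) * l) := by
  -- Young's inequality, weighted to spend exactly half of the `2 * c * ρ ^ 2` available in `v`.
  have h3 : 2 * y * q ≤ c * (y ^ 2 * ρ ^ 2) + 1 / c * e ^ 2 := by
    have h5 : 2 * y * q ≤ 2 * (|y| * ρ) * e := by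
      refine (le_abs_self _).trans ?_
      rw [abs_mul, abs_mul, abs_two]
      calc _ ≤ 2 * |y| * (e * ρ) := by gcongr
        _ = _ := by ring
    refine h5.trans ?_
    rw [← sq_abs y, ← mul_pow]
    have h6 : 0 ≤ (c * (|y| * ρ) - e) ^ 2 / c := by positivity
    have h7 : (c * (|y| * ρ) - e) ^ 2 / c = c * (|y| * ρ) ^ 2
        - 2 * (|y| * ρ) * e + 1 / c * e ^ 2 := by
      field_simp
      ring
    linarith
  have h8 : y ^ 2 * (c * ρ ^ 2 - K * ρ - N) ≤ y ^ 2 * v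
      - (2 * y * q + N * y ^ 2) + 1 / c * e ^ 2 := by
    linarith [mul_le_mul_of_nonneg_left hv (sq_nonneg y)]
  -- Inside the ball the coefficient of `l` compensates for the possibly negative bracket. Outside,
  -- `hcR` gives `c * ρ ^ 2 ≥ (c + K + N + 1) * ρ` with `ρ > 1`, so the bracket is at least one.
  have h9 : y ^ 2 * w ≤ y ^ 2 * (c * ρ ^ 2 - K * ρ - N) * w + (1 + K * R + N) * l := by
    rcases le_or_gt ρ R with hx | hx
    · rw [hin hx]
      have h10 : 0 ≤ c * ρ ^ 2 + K * (R - ρ) := by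
        have : 0 ≤ R - ρ := by linarith
        positivity
      linarith [mul_nonneg (mul_nonneg (sq_nonneg y) hw) h10]
    · rw [hout hx, mul_zero, add_zero]
      have h10 : 1 ≤ c * ρ ^ 2 - K * ρ - N := by
        have h11 : c * R * ρ ≤ c * ρ ^ 2 := by
          rw [sq, mul_assoc]; gcongr
        rw [hcR] at h11
        nlinarith
      exact mul_le_mul_of_nonneg_right (le_mul_of_one_le_right (sq_nonneg _) h10) hw
  linarith [mul_le_mul_of_nonneg_right h8 hw]

open Module in
/-- A Lyapunov estimate: up to the gradient energy, the mass of `u ^ 2` is carried by a ball. -/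
theorem integral_sq_mul_exp_le {c : ℝ} (hc : 0 < c) {G : E → ℝ} (hG : Differentiable ℝ G)
    (hG0 : ∀ x, 0 ≤ G x) {K : ℝ} (hG' : ∀ x, ‖fderiv ℝ G x‖ ≤ K) {R : ℝ} (hR : 1 ≤ R)
    (hcR : c * R = c + (K + finrank ℝ E + 1)) {u : E → ℝ} (huc : ContDiff ℝ 1 u) {A : ℝ}
    (huA : ∀ x, |u x| ≤ A) (huA' : ∀ x, ‖fderiv ℝ u x‖ ≤ A) :
    ∫ x, u x ^ 2 * Real.exp (-(c * ‖x‖ ^ 2 + G x)) ≤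
      1 / c * (∫ x, ‖fderiv ℝ u x‖ ^ 2 * Real.exp (-(c * ‖x‖ ^ 2 + G x)))
        + (1 + K * R + finrank ℝ E) * ∫ x in Metric.closedBall (0 : E) R,
          u x ^ 2 * Real.exp (-(c * ‖x‖ ^ 2 + G x)) := by
  set V : E → ℝ := fun x => c * ‖x‖ ^ 2 + G x with hVdef
  set N : ℝ := (finrank ℝ E : ℝ) with hN
  have hN0 : 0 ≤ N := Nat.cast_nonneg _
  have hK0 : 0 ≤ K := (norm_nonneg _).trans (hG' 0)
  have hVd : Differentiable ℝ V := 
    (((contDiff_norm_sq ℝ (n := 1)).differentiable (by norm_num)).const_mul c).add hG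
  have hVm : Measurable V := hVd.continuous.measurable
  have hVc : ∀ x, c * ‖x‖ ^ 2 ≤ V x := fun x => by simp [hVdef, hG0 x]
  have hV' : ∀ x v, fderiv ℝ V x v = 2 * c * inner ℝ x v + fderiv ℝ G x v := fun x v => by
    have h1 : HasFDerivAt (fun x : E => ‖x‖ ^ 2) (2 • (innerSL ℝ x)) x :=
      (hasStrictFDerivAt_norm_sq x).hasFDerivAt
    have h2 := (h1.const_mul c).add (hG x).hasFDerivAt
    rw [show V = ((fun y : E => c * ‖y‖ ^ 2) + G) from rfl, h2.fderiv]
    simp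
    ring
  have hV'n : ∀ x, ‖fderiv ℝ V x‖ ≤ (2 * c + K) * (1 + ‖x‖) := fun x => by
    refine ContinuousLinearMap.opNorm_le_bound _ (by positivity) fun v => ?_
    rw [hV', Real.norm_eq_abs]
    have h1 := abs_real_inner_le_norm x v
    have h2 : |fderiv ℝ G x v| ≤ K * ‖v‖ := (fderiv ℝ G x).le_of_opNorm_le (hG' x) v
    have h3 : |2 * c * inner ℝ x v| ≤ 2 * c * (‖x‖ * ‖v‖) := by
      rw [abs_mul, abs_of_nonneg (by positivity)]; gcongr
    refine (abs_add_le _ _).trans ((add_le_add h3 h2).trans ?_)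
    have h4 : 0 ≤ 2 * c * ‖v‖ := by positivity
    have h5 : 0 ≤ K * ‖x‖ * ‖v‖ := by positivity
    nlinarith
  set B := Metric.closedBall (0 : E) R with hB
  have hucont := huc.continuous
  have huc' : Continuous (fderiv ℝ u) := huc.continuous_fderiv (by norm_num)
  have hA0 : 0 ≤ A := (abs_nonneg _).trans (huA 0)
  have hu2 : ∀ x, u x ^ 2 ≤ A ^ 2 := fun x => sq_le_sq' (abs_le.1 (huA x)).1 (abs_le.1 (huA x)).2
  have hr : ∀ x : E, ‖x‖ ≤ 1 + ‖x‖ ^ 2 := fun x => by nlinarith [sq_nonneg (‖x‖ - 1)]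
  have hibp := integral_sq_mul_fderiv_apply_self hc hVd hVc hV'n huc huA huA'
  have hI1 : Integrable fun x => u x ^ 2 * Real.exp (-V x) :=
    integrable_mul_exp_neg_of_quadratic_growth hc hVm hVc (A := A ^ 2) (by fun_prop) fun x => by
      rw [abs_of_nonneg (sq_nonneg _)]
      nlinarith [hu2 x, mul_nonneg (sq_nonneg A) (sq_nonneg ‖x‖)]
  have hI2 : Integrable fun x => ‖fderiv ℝ u x‖ ^ 2 * Real.exp (-V x) :=
    integrable_mul_exp_neg_of_quadratic_growth hc hVm hVc (A := A ^ 2) (by fun_prop) fun x => by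
      rw [abs_of_nonneg (sq_nonneg _)]
      have : ‖fderiv ℝ u x‖ ^ 2 ≤ A ^ 2 := by gcongr; exact huA' x
      nlinarith [mul_nonneg (sq_nonneg A) (sq_nonneg ‖x‖)]
  have hI3 : Integrable fun x => (u x ^ 2 * fderiv ℝ V x x) * Real.exp (-V x) := by
    refine integrable_mul_exp_neg_of_quadratic_growth hc hVm hVc (A := A ^ 2 * (2 * (2 * c + K)))
      ?_ fun x => ?_
    · simp only [hV']
      -- `G` is only assumed differentiable, so its derivative is measurable but perhaps not
      -- continuous.
      have := measurable_fderiv ℝ G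
      have h2 : Measurable fun x => fderiv ℝ G x x :=
        (isBoundedBilinearMap_apply (𝕜 := ℝ) (E := E) (F := ℝ)).continuous.measurable.comp
          (this.prodMk measurable_id)
      fun_prop
    · rw [abs_mul, abs_of_nonneg (sq_nonneg _)]
      have h1 : |fderiv ℝ V x x| ≤ (2 * c + K) * (1 + ‖x‖) * ‖x‖ :=
        (fderiv ℝ V x).le_of_opNorm_le (hV'n x) x
      have h2 : (1 + ‖x‖) * ‖x‖ ≤ 2 * (1 + ‖x‖ ^ 2) := by nlinarith [hr x]
      calc u x ^ 2 * |fderiv ℝ V x x| ≤ A ^ 2 * ((2 * c + K) * ((1 + ‖x‖) * ‖x‖)) := by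
            rw [← mul_assoc (2 * c + K)]
            have h2 := hu2 x
            have h0 := sq_nonneg (u x)
            generalize u x ^ 2 = q at h2 h0 ⊢
            gcongr
        _ ≤ A ^ 2 * ((2 * c + K) * (2 * (1 + ‖x‖ ^ 2))) := by gcongr
        _ = _ := by ring
  have hI4 : Integrable fun x => (2 * u x * fderiv ℝ u x x + N * u x ^ 2) * Real.exp (-V x) := by
    refine integrable_mul_exp_neg_of_quadratic_growth hc hVm hVc (A := (2 + N) * A ^ 2)
      ?_ fun x => ?_
    · fun_prop
    · have h1 : |fderiv ℝ u x x| ≤ A * ‖x‖ := (fderiv ℝ u x).le_of_opNorm_le (huA' x) x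
      refine (abs_add_le _ _).trans ?_
      rw [abs_mul, abs_mul, abs_mul, abs_two, abs_of_nonneg hN0,
        abs_of_nonneg (sq_nonneg (u x))]
      calc 2 * |u x| * |fderiv ℝ u x x| + N * u x ^ 2
          ≤ 2 * A * (A * (1 + ‖x‖ ^ 2)) + N * A ^ 2 := by
            have := h1.trans (mul_le_mul_of_nonneg_left (hr x) hA0)
            have := huA x
            have h2 := hu2 x
            generalize u x ^ 2 = q at h2 ⊢
            gcongr
        _ ≤ _ := by nlinarith [mul_nonneg (mul_nonneg hN0 (sq_nonneg A)) (sq_nonneg ‖x‖)]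
  set χ : E → ℝ := B.indicator fun x => u x ^ 2 * Real.exp (-V x) with hχ
  have hI5 : Integrable χ := hI1.indicator measurableSet_closedBall
  have pt : ∀ x, u x ^ 2 * Real.exp (-V x) ≤ (u x ^ 2 * fderiv ℝ V x x) * Real.exp (-V x)
      - (2 * u x * fderiv ℝ u x x + N * u x ^ 2) * Real.exp (-V x)
      + (1 / c * (‖fderiv ℝ u x‖ ^ 2 * Real.exp (-V x)) + (1 + K * R + N) * χ x) := by
    intro x
    refine sq_mul_le_of_radial_growth hc hK0 hN0 hR hcR (norm_nonneg x) (Real.exp_pos _).le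
      ((fderiv ℝ u x).le_opNorm x) ?_ (fun hx => ?_) fun hx => ?_
    · have h2 : |fderiv ℝ G x x| ≤ K * ‖x‖ := (fderiv ℝ G x).le_of_opNorm_le (hG' x) x
      rw [hV', real_inner_self_eq_norm_sq]
      linarith [neg_abs_le (fderiv ℝ G x x)]
    · exact Set.indicator_of_mem (mem_closedBall_zero_iff.2 hx) _
    · exact Set.indicator_of_notMem (by simpa [hB] using hx) _
  have h1 := integral_mono hI1 ((hI3.sub hI4).add
    ((hI2.const_mul (1 / c)).add (hI5.const_mul (1 + K * R + N)))) pt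
  -- By `hibp` the first two terms of `pt` have equal integrals and cancel, leaving the gradient
  -- energy and the mass in the ball.
  rw [integral_add' (hI3.sub hI4) ((hI2.const_mul (1 / c)).add (hI5.const_mul (1 + K * R + N))),
    integral_sub' hI3 hI4, integral_add' (hI2.const_mul (1 / c)) (hI5.const_mul (1 + K * R + N)),
    integral_const_mul, integral_const_mul, hibp, sub_self, zero_add, hχ,
    integral_indicator measurableSet_closedBall] at h1
  exact h1

open Module in
/-- Poincaré's inequality, up to the choice of the centring constant, for the measure with density
`exp (-(c * ‖x‖ ^ 2 + G x))`, where `G` is nonnegative and has bounded derivative. -/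
theorem exists_weighted_poincare {c : ℝ} (hc : 0 < c) {G : E → ℝ} (hG : Differentiable ℝ G)
    (hG0 : ∀ x, 0 ≤ G x) {K : ℝ} (hG' : ∀ x, ‖fderiv ℝ G x‖ ≤ K) :
    ∃ C : ℝ, 0 < C ∧ ∀ h : E → ℝ, ContDiff ℝ 1 h → HasCompactSupport h → ∃ m : ℝ,
      ∫ x, (h x - m) ^ 2 * Real.exp (-(c * ‖x‖ ^ 2 + G x)) ≤
        C * ∫ x, ‖fderiv ℝ h x‖ ^ 2 * Real.exp (-(c * ‖x‖ ^ 2 + G x)) := by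
  set V : E → ℝ := fun x => c * ‖x‖ ^ 2 + G x with hVdef
  have hVd : Differentiable ℝ V :=
    (((contDiff_norm_sq ℝ (n := 1)).differentiable (by norm_num)).const_mul c).add hG
  have hVm : Measurable V := hVd.continuous.measurable
  have hVc : ∀ x, c * ‖x‖ ^ 2 ≤ V x := fun x => by simp [hVdef, hG0 x]
  set N : ℝ := (finrank ℝ E : ℝ) with hN
  have hN0 : 0 ≤ N := Nat.cast_nonneg _
  have hK0 : 0 ≤ K := (norm_nonneg _).trans (hG' 0)
  -- Solves `c * R = c + (K + N + 1)`, the radius beyond which the radial growth dominates.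
  set R : ℝ := 1 + (K + N + 1) / c with hR
  have hR0 : 0 < R := by positivity
  have hcR : c * R = c + (K + N + 1) := by rw [hR]; field_simp
  have hR1 : 1 ≤ R := by rw [hR]; linarith [show 0 ≤ (K + N + 1) / c by positivity]
  set B := Metric.closedBall (0 : E) R with hB
  -- The minimum of the density on the ball bounds it below by a positive number; the upper bound is
  -- `1`, since `V` is nonnegative.
  obtain ⟨z, hz, hzmin⟩ := (isCompact_closedBall (0 : E) R).exists_isMinOn
    (f := fun x => Real.exp (-V x)) ⟨0, by simp [hR0.le]⟩ (by
      have := hVd.continuous; fun_prop)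
  set δ := Real.exp (-V z) with hδ
  have hδ0 : 0 < δ := Real.exp_pos _
  set C₁ : ℝ := (2 * R) ^ 2 * 2 ^ finrank ℝ E with hC₁
  have hC₁0 : 0 < C₁ := by positivity
  refine ⟨1 / c + (1 + K * R + N) * (C₁ / δ), by positivity, fun h hh hcs => ?_⟩
  obtain ⟨m, hm⟩ := exists_integral_closedBall_sq_sub_le hR0 hh
  refine ⟨m, ?_⟩
  have hhc : Continuous h := hh.continuous
  have hhc' : Continuous (fderiv ℝ h) := hh.continuous_fderiv (by norm_num)
  obtain ⟨A₁, hA₁⟩ := hcs.exists_bound_of_continuous hhc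
  obtain ⟨A₂, hA₂⟩ := (hcs.fderiv (𝕜 := ℝ)).exists_bound_of_continuous hhc'
  -- The shifted function `h - m` generally loses compact support, but it and its derivative stay
  -- bounded, which suffices for the Lyapunov estimate.
  set A := max (A₁ + |m|) A₂ with hAdef
  set u : E → ℝ := fun x => h x - m with hu
  have huc : ContDiff ℝ 1 u := hh.sub contDiff_const
  have hucont := huc.continuous
  have hu' : ∀ x, fderiv ℝ u x = fderiv ℝ h x := fun x => fderiv_sub_const m
  have huA : ∀ x, |u x| ≤ A := fun x =>
    ((abs_sub _ _).trans (add_le_add (hA₁ x) le_rfl)).trans (le_max_left _ _)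
  have huA' : ∀ x, ‖fderiv ℝ u x‖ ≤ A := fun x => by
    rw [hu']; exact (hA₂ x).trans (le_max_right _ _)
  have hA0 : 0 ≤ A := (abs_nonneg _).trans (huA 0)
  have hu2 : ∀ x, u x ^ 2 ≤ A ^ 2 := fun x => sq_le_sq' (abs_le.1 (huA x)).1 (abs_le.1 (huA x)).2
  have hI1 : Integrable fun x => u x ^ 2 * Real.exp (-V x) :=
    integrable_mul_exp_neg_of_quadratic_growth hc hVm hVc (A := A ^ 2) (by fun_prop) fun x => by
      rw [abs_of_nonneg (sq_nonneg _)]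
      nlinarith [hu2 x, mul_nonneg (sq_nonneg A) (sq_nonneg ‖x‖)]
  have hI2 : Integrable fun x => ‖fderiv ℝ h x‖ ^ 2 * Real.exp (-V x) :=
    integrable_mul_exp_neg_of_quadratic_growth hc hVm hVc (A := A ^ 2) (by fun_prop) fun x => by
      rw [abs_of_nonneg (sq_nonneg _), ← hu']
      have : ‖fderiv ℝ u x‖ ^ 2 ≤ A ^ 2 := by gcongr; exact huA' x
      nlinarith [mul_nonneg (sq_nonneg A) (sq_nonneg ‖x‖)]
  have hloc : ∫ x in B, u x ^ 2 * Real.exp (-V x) ≤ C₁ / δ * ∫ x, ‖fderiv ℝ h x‖ ^ 2 * Real.exp (-V x) := by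
    have hcomp : IsCompact B := isCompact_closedBall _ _
    calc ∫ x in B, u x ^ 2 * Real.exp (-V x) ≤ ∫ x in B, u x ^ 2 := by
          refine setIntegral_mono_on hI1.integrableOn
            (ContinuousOn.integrableOn_compact hcomp (by fun_prop)) measurableSet_closedBall
            fun x _ => mul_le_of_le_one_right (sq_nonneg _) ?_
          have : 0 ≤ c * ‖x‖ ^ 2 := by positivity
          exact Real.exp_le_one_iff.2 (by linarith [hVc x])
      _ ≤ C₁ * ∫ x in B, ‖fderiv ℝ h x‖ ^ 2 := hm
      _ ≤ C₁ * ∫ x in B, 1 / δ * (‖fderiv ℝ h x‖ ^ 2 * Real.exp (-V x)) := by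
          refine mul_le_mul_of_nonneg_left ?_ hC₁0.le
          refine setIntegral_mono_on (ContinuousOn.integrableOn_compact hcomp (by fun_prop))
            (hI2.const_mul _).integrableOn measurableSet_closedBall fun x hx => ?_
          have h1 : δ ≤ Real.exp (-V x) := hzmin hx
          rw [one_div, inv_mul_eq_div, le_div_iff₀ hδ0]
          gcongr
      _ = C₁ / δ * ∫ x in B, ‖fderiv ℝ h x‖ ^ 2 * Real.exp (-V x) := by
          rw [integral_const_mul]; ring
      _ ≤ _ := by
          refine mul_le_mul_of_nonneg_left ?_ (by positivity)
          exact setIntegral_le_integral hI2 (ae_of_all _ fun x => by positivity)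
  have hfin : ∫ x, u x ^ 2 * Real.exp (-V x) ≤
      1 / c * (∫ x, ‖fderiv ℝ h x‖ ^ 2 * Real.exp (-V x))
        + (1 + K * R + N) * ∫ x in B, u x ^ 2 * Real.exp (-V x) := by
    simpa only [hu'] using integral_sq_mul_exp_le hc hG hG0 hG' hR1 hcR huc huA huA'
  have h0 : 0 ≤ 1 + K * R + N := by positivity
  exact (hfin.trans (add_le_add_right (mul_le_mul_of_nonneg_left hloc h0) _)).trans_eq (by ring)

end WeightedPoincare

/-! ### Gibbs measures of quadratically regularized functions. -/

theorem norm_gradient_eq {F : Type*} [NormedAddCommGroup F] [InnerProductSpace ℝ F]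
    [CompleteSpace F] (f : F → ℝ) (x : F) : ‖gradient f x‖ = ‖fderiv ℝ f x‖ :=
  (InnerProductSpace.toDual ℝ F).symm.norm_map _

/-- The variance is at most the mean square distance to any constant, so the unspecified centring in
`exists_weighted_poincare` is harmless; the normalization multiplies both sides. -/
theorem exists_gibbsPoincare_quadratic_add {ι : Type*} [Fintype ι] {g : EuclideanSpace ℝ ι → ℝ}
    (hg : Differentiable ℝ g) (hg0 : ∀ x, 0 ≤ g x) {K : ℝ} (hg' : ∀ x, ‖fderiv ℝ g x‖ ≤ K)
    {lam : ℝ} (hlam : 0 < lam) {s : ℝ} (hs : 0 < s) :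
    ∃ lam_s : ℝ, 0 < lam_s ∧ GibbsPoincare (fun x => g x + lam / 2 * ‖x‖ ^ 2) s lam_s := by
  set f : EuclideanSpace ℝ ι → ℝ := fun x => g x + lam / 2 * ‖x‖ ^ 2 with hf
  have hc : 0 < lam / s := by positivity
  have hexp : ∀ x, -2 * f x / s = -(lam / s * ‖x‖ ^ 2 + 2 / s * g x) := fun x => by
    rw [hf]; field_simp; ring
  obtain ⟨C, hC, hP⟩ := exists_weighted_poincare hc (hg.const_mul (2 / s))
    (fun x => mul_nonneg (by positivity) (hg0 x)) (K := 2 / s * K) fun x => by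
      rw [fderiv_const_mul (hg x), norm_smul, Real.norm_of_nonneg (by positivity)]
      gcongr
      exact hg' x
  have hgm : Measurable g := hg.continuous.measurable
  have hint : Integrable (fun x => Real.exp (-2 * f x / s)) volume := by
    have := integrable_mul_exp_neg_of_quadratic_growth hc
      (V := fun x : EuclideanSpace ℝ ι => lam / s * ‖x‖ ^ 2 + 2 / s * g x)
      (by fun_prop) (fun x => by
        have := mul_nonneg (show 0 ≤ 2 / s by positivity) (hg0 x)
        simpa using this) (f := fun _ => 1) measurable_const (A := 1) fun x => by
        simp
    simpa only [hexp, one_mul] using this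
  have hprob : IsProbabilityMeasure (gibbsMeasure f s) := isProbabilityMeasure_tilted hint
  -- Chosen so that `s / (2 * lam_s) = C`.
  refine ⟨s / (2 * C), by positivity, hint, hprob, fun h hh hcs => ?_⟩
  obtain ⟨m, hm⟩ := hP h (hh.of_le (by simp)) hcs
  set Z : ℝ := ∫ x, Real.exp (-2 * f x / s) with hZ
  have hZ0 : 0 < Z := integral_exp_pos hint
  have hI : ∀ F : EuclideanSpace ℝ ι → ℝ, ∫ x, F x ∂(gibbsMeasure f s)
      = Z⁻¹ * ∫ x, F x * Real.exp (-(lam / s * ‖x‖ ^ 2 + 2 / s * g x)) := fun F => by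
    rw [gibbsMeasure, integral_tilted, ← integral_const_mul, ← hZ]
    congr 1 with x
    rw [smul_eq_mul, hexp]
    ring
  have hmeas : Measurable h := hh.continuous.measurable
  calc ProbabilityTheory.variance h (gibbsMeasure f s)
      = ProbabilityTheory.variance (fun x => h x - m) (gibbsMeasure f s) :=
        (ProbabilityTheory.variance_sub_const hmeas.aestronglyMeasurable m).symm
    _ ≤ ∫ x, (h x - m) ^ 2 ∂(gibbsMeasure f s) :=
        ProbabilityTheory.variance_le_expectation_sq (by fun_prop)
    _ ≤ C * ∫ x, ‖fderiv ℝ h x‖ ^ 2 ∂(gibbsMeasure f s) := by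
        rw [hI, hI, mul_left_comm]
        gcongr
    _ = s / (2 * (s / (2 * C))) * ∫ x, ‖gradient h x‖ ^ 2 ∂(gibbsMeasure f s) := by
        simp_rw [norm_gradient_eq]
        congr 1
        field_simp

/-! ### The net and its derivative in the weights -/

/-- The preactivation `W ↦ (W x)_j` of the `j`-th neuron, as a linear form in the weights. -/
noncomputable def preactivation {p d : ℕ} (x : EuclideanSpace ℝ (Fin d)) (j : Fin p) : Weights p d →L[ℝ] ℝ :=
  ∑ k, x k • EuclideanSpace.proj (j, k)

theorem preactivation_apply {p d : ℕ} (x : EuclideanSpace ℝ (Fin d)) (j : Fin p)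
    (W : Weights p d) : preactivation x j W = ∑ k, W (j, k) * x k := by
  simp [preactivation, mul_comm]

theorem net_eq_sum {p d : ℕ} (σ : ℝ → ℝ) (a : EuclideanSpace ℝ (Fin p)) (W : Weights p d)
    (x : EuclideanSpace ℝ (Fin d)) : net σ a W x = ∑ j, a j * σ (preactivation x j W) := by
  simp [net, preactivation_apply, Matrix.mulVec, dotProduct, Weights.toMatrix]

/-- Cauchy–Schwarz in each row of the weight matrix. -/
theorem sum_preactivation_sq_le {p d : ℕ} (x : EuclideanSpace ℝ (Fin d)) (W : Weights p d) :
    ∑ j, preactivation x j W ^ 2 ≤ (‖x‖ * ‖W‖) ^ 2 := by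
  rw [mul_pow, EuclideanSpace.real_norm_sq_eq, EuclideanSpace.real_norm_sq_eq,
    Fintype.sum_prod_type, Finset.mul_sum]
  refine Finset.sum_le_sum fun j _ => ?_
  rw [preactivation_apply, mul_comm]
  exact Finset.sum_mul_sq_le_sq_mul_sq _ _ _

theorem sum_abs_mul_abs_preactivation_le {p d : ℕ} (a : EuclideanSpace ℝ (Fin p))
    (x : EuclideanSpace ℝ (Fin d)) (W : Weights p d) :
    ∑ j, |a j| * |preactivation x j W| ≤ ‖a‖ * (‖x‖ * ‖W‖) := by
  refine abs_le_of_sq_le_sq' ?_ (by positivity) |>.2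
  refine (Finset.sum_mul_sq_le_sq_mul_sq _ _ _).trans ?_
  simp only [sq_abs]
  rw [mul_pow, EuclideanSpace.real_norm_sq_eq a]
  exact mul_le_mul_of_nonneg_left (sum_preactivation_sq_le x W)
    (Finset.sum_nonneg fun _ _ => sq_nonneg _)

theorem abs_preactivation_le {p d : ℕ} (x : EuclideanSpace ℝ (Fin d)) (j : Fin p)
    (W : Weights p d) : |preactivation x j W| ≤ ‖x‖ * ‖W‖ := by
  refine abs_le_of_sq_le_sq ?_ (by positivity)
  exact (Finset.single_le_sum (f := fun j => preactivation x j W ^ 2)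
    (fun _ _ => sq_nonneg _) (Finset.mem_univ j)).trans (sum_preactivation_sq_le x W)

/-- The derivative of the net in the weights. -/
noncomputable def netDeriv {p d : ℕ} (σ : ℝ → ℝ) (a : EuclideanSpace ℝ (Fin p)) (W : Weights p d)
    (x : EuclideanSpace ℝ (Fin d)) : Weights p d →L[ℝ] ℝ :=
  ∑ j, (a j * deriv σ (preactivation x j W)) • preactivation x j

theorem hasFDerivAt_net {p d : ℕ} {σ : ℝ → ℝ} (hσ : Differentiable ℝ σ)
    (a : EuclideanSpace ℝ (Fin p)) (W : Weights p d) (x : EuclideanSpace ℝ (Fin d)) :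
    HasFDerivAt (fun W => net σ a W x) (netDeriv σ a W x) W := by
  simp_rw [net_eq_sum]
  refine HasFDerivAt.fun_sum fun j _ => ?_
  have h := ((hσ (preactivation x j W)).hasDerivAt.comp_hasFDerivAt W
    (preactivation x j).hasFDerivAt).const_mul (a j)
  rwa [smul_smul] at h

theorem contDiff_net {p d : ℕ} {σ : ℝ → ℝ} (hσ : ContDiff ℝ ∞ σ)
    (a : EuclideanSpace ℝ (Fin p)) (x : EuclideanSpace ℝ (Fin d)) :
    ContDiff ℝ ∞ fun W : Weights p d => net σ a W x := by
  simp_rw [net_eq_sum]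
  exact ContDiff.sum fun j _ => contDiff_const.mul (hσ.comp (preactivation x j).contDiff)

theorem norm_netDeriv_le {p d : ℕ} {σ : ℝ → ℝ} {M : ℝ} (hM : ∀ z, |deriv σ z| ≤ M)
    (a : EuclideanSpace ℝ (Fin p)) (W : Weights p d) (x : EuclideanSpace ℝ (Fin d)) :
    ‖netDeriv σ a W x‖ ≤ ‖a‖ * M * ‖x‖ := by
  have hM0 : 0 ≤ M := (abs_nonneg _).trans (hM 0)
  refine ContinuousLinearMap.opNorm_le_bound _ (by positivity) fun H => ?_
  simp only [netDeriv, FunLike.coe_sum, Finset.sum_apply, FunLike.coe_smul, Pi.smul_apply,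
    smul_eq_mul, Real.norm_eq_abs]
  calc |∑ j, a j * deriv σ (preactivation x j W) * preactivation x j H|
      ≤ ∑ j, M * (|a j| * |preactivation x j H|) := by
        refine (Finset.abs_sum_le_sum_abs _ _).trans (Finset.sum_le_sum fun j _ => ?_)
        rw [abs_mul, abs_mul, mul_comm |a j|, mul_assoc]
        exact mul_le_mul_of_nonneg_right (hM _) (by positivity)
    _ ≤ M * (‖a‖ * (‖x‖ * ‖H‖)) := by
        rw [← Finset.mul_sum]
        exact mul_le_mul_of_nonneg_left (sum_abs_mul_abs_preactivation_le a x H) hM0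
    _ = _ := by ring

/-- Each preactivation moves by at most `‖x‖ * ‖W - W'‖`; Cauchy–Schwarz over the neurons then keeps
the constant free of `p`. -/
theorem norm_netDeriv_sub_le {p d : ℕ} {σ : ℝ → ℝ} {M : ℝ} (hM0 : 0 ≤ M)
    (hM : ∀ z w, |deriv σ z - deriv σ w| ≤ M * |z - w|)
    (a : EuclideanSpace ℝ (Fin p)) (W W' : Weights p d) (x : EuclideanSpace ℝ (Fin d)) :
    ‖netDeriv σ a W x - netDeriv σ a W' x‖ ≤ ‖a‖ * M * ‖x‖ ^ 2 * ‖W - W'‖ := by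
  refine ContinuousLinearMap.opNorm_le_bound _ (by positivity) fun H => ?_
  simp only [netDeriv, FunLike.coe_sum, Finset.sum_apply, FunLike.coe_smul, Pi.smul_apply,
    smul_eq_mul, Real.norm_eq_abs, FunLike.coe_sub, Pi.sub_apply, ← Finset.sum_sub_distrib]
  calc |∑ j, (a j * deriv σ (preactivation x j W) * preactivation x j H -
          a j * deriv σ (preactivation x j W') * preactivation x j H)|
      ≤ ∑ j, M * (‖x‖ * ‖W - W'‖) * (|a j| * |preactivation x j H|) := by
        refine (Finset.abs_sum_le_sum_abs _ _).trans (Finset.sum_le_sum fun j _ => ?_)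
        rw [← sub_mul, ← mul_sub, abs_mul, abs_mul, mul_comm |a j|, mul_assoc]
        refine mul_le_mul_of_nonneg_right ((hM _ _).trans ?_) (by positivity)
        rw [← map_sub]
        exact mul_le_mul_of_nonneg_left (abs_preactivation_le x j _) hM0
    _ ≤ M * (‖x‖ * ‖W - W'‖) * (‖a‖ * (‖x‖ * ‖H‖)) := by
        rw [← Finset.mul_sum]
        exact mul_le_mul_of_nonneg_left (sum_abs_mul_abs_preactivation_le a x H) (by positivity)
    _ = _ := by ring

theorem abs_net_sub_le {p d : ℕ} {σ : ℝ → ℝ} (hσ : Differentiable ℝ σ) {M : ℝ}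
    (hM : ∀ z, |deriv σ z| ≤ M)
    (a : EuclideanSpace ℝ (Fin p)) (W W' : Weights p d) (x : EuclideanSpace ℝ (Fin d)) :
    |net σ a W x - net σ a W' x| ≤ ‖a‖ * M * ‖x‖ * ‖W - W'‖ :=
  Convex.norm_image_sub_le_of_norm_hasFDerivWithin_le (s := Set.univ)
    (fun W _ => (hasFDerivAt_net hσ a W x).hasFDerivWithinAt)
    (fun W _ => norm_netDeriv_le hM a W x) convex_univ (Set.mem_univ _) (Set.mem_univ _)

/-- The factor `√p` is the cost of passing from the `ℓ¹` norm of `a` to its Euclidean norm. -/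
theorem abs_net_le {p d : ℕ} {σ : ℝ → ℝ} {B : ℝ} (hB : ∀ z, |σ z| ≤ B)
    (a : EuclideanSpace ℝ (Fin p)) (W : Weights p d) (x : EuclideanSpace ℝ (Fin d)) :
    |net σ a W x| ≤ √p * (‖a‖ * B) := by
  have hB0 : 0 ≤ B := (abs_nonneg _).trans (hB 0)
  have h1 : ∑ j, |a j| ≤ √p * ‖a‖ := by
    refine abs_le_of_sq_le_sq' ?_ (by positivity) |>.2
    rw [mul_pow, Real.sq_sqrt (Nat.cast_nonneg p), EuclideanSpace.real_norm_sq_eq]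
    simpa using sq_sum_le_card_mul_sum_sq (s := Finset.univ) (f := fun j => |a j|)
  rw [net_eq_sum]
  calc |∑ j, a j * σ (preactivation x j W)| ≤ ∑ j, |a j| * B := by
        refine (Finset.abs_sum_le_sum_abs _ _).trans (Finset.sum_le_sum fun j _ => ?_)
        rw [abs_mul]
        exact mul_le_mul_of_nonneg_left (hB _) (abs_nonneg _)
    _ ≤ √p * ‖a‖ * B := by rw [← Finset.sum_mul]; gcongr
    _ = _ := by ring

/-! ### The logistic loss -/

theorem hasDerivAt_log_one_add_exp (z : ℝ) :
    HasDerivAt (fun z => Real.log (1 + Real.exp z)) (Real.sigmoid z) z := by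
  have h := ((Real.hasDerivAt_exp z).const_add 1).log (by positivity)
  convert! h using 1
  rw [Real.sigmoid_def, Real.exp_neg]
  have := Real.exp_pos z
  field_simp
  ring

theorem abs_sigmoid_sub_le (z w : ℝ) : |Real.sigmoid z - Real.sigmoid w| ≤ 1 / 4 * |z - w| := by
  refine Convex.norm_image_sub_le_of_norm_hasDerivWithin_le (s := Set.univ)
    (fun t _ => (Real.hasDerivAt_sigmoid t).hasDerivWithinAt) (fun t _ => ?_) convex_univ
    (Set.mem_univ _) (Set.mem_univ _)
  rw [Real.norm_of_nonneg (mul_nonneg (Real.sigmoid_nonneg t)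
    (by linarith [Real.sigmoid_le_one t]))]
  nlinarith [sq_nonneg (Real.sigmoid t - 1 / 2)]

/-- The sigmoid is `1 / 2` at zero and `1 / 4`-Lipschitz. This is the source of the `2` and the `4`
in the second term of the final constant. -/
theorem sigmoid_le_two_add_abs_div (z : ℝ) : Real.sigmoid z ≤ (2 + |z|) / 4 := by
  have h := (le_abs_self _).trans (abs_sigmoid_sub_le z 0)
  rw [Real.sigmoid_zero, sub_zero] at h
  linarith

theorem norm_average_le {n : ℕ} {F : Type*} [NormedAddCommGroup F] [NormedSpace ℝ F]
    {v : Fin n → F} {C : ℝ} (hC : 0 ≤ C) (hv : ∀ i, ‖v i‖ ≤ C) :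
    ‖(1 / (n : ℝ)) • ∑ i, v i‖ ≤ C := by
  rw [norm_smul, Real.norm_of_nonneg (by positivity)]
  have h : ‖∑ i, v i‖ ≤ n * C := by
    simpa using norm_sum_le_of_le Finset.univ fun i _ => hv i
  calc 1 / (n : ℝ) * ‖∑ i, v i‖ ≤ 1 / (n : ℝ) * (n * C) := by gcongr
    _ = (n / n : ℝ) * C := by ring
    -- An inequality rather than `n / n = 1`, because `n = 0` is allowed and then `n / n = 0`.
    _ ≤ C := mul_le_of_le_one_left hC (div_self_le_one _)

/-- The logistic empirical risk, without regularization. -/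
noncomputable def logisticRisk {n p d : ℕ} (σ : ℝ → ℝ) (a : EuclideanSpace ℝ (Fin p))
    (x : Fin n → EuclideanSpace ℝ (Fin d)) (y : Fin n → ℝ) (W : Weights p d) : ℝ :=
  1 / (n : ℝ) * ∑ i, Real.log (1 + Real.exp (-(y i) * net σ a W (x i)))

/-- The derivative of the logistic loss at one data point. -/
noncomputable def sampleDeriv {p d : ℕ} (σ : ℝ → ℝ) (a : EuclideanSpace ℝ (Fin p))
    (x : EuclideanSpace ℝ (Fin d)) (y : ℝ) (W : Weights p d) : Weights p d →L[ℝ] ℝ :=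
  Real.sigmoid (-y * net σ a W x) • (-y) • netDeriv σ a W x

theorem hasFDerivAt_logisticRisk {n p d : ℕ} {σ : ℝ → ℝ} (hσ : Differentiable ℝ σ)
    (a : EuclideanSpace ℝ (Fin p)) (x : Fin n → EuclideanSpace ℝ (Fin d)) (y : Fin n → ℝ)
    (W : Weights p d) : HasFDerivAt (logisticRisk σ a x y)
      ((1 / (n : ℝ)) • ∑ i, sampleDeriv σ a (x i) (y i) W) W := by
  refine HasFDerivAt.const_mul (HasFDerivAt.fun_sum fun i _ => ?_) _
  exact (hasDerivAt_log_one_add_exp _).comp_hasFDerivAt W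
    ((hasFDerivAt_net hσ a W (x i)).const_mul (-(y i)))

theorem logisticRisk_nonneg {n p d : ℕ} (σ : ℝ → ℝ) (a : EuclideanSpace ℝ (Fin p))
    (x : Fin n → EuclideanSpace ℝ (Fin d)) (y : Fin n → ℝ) (W : Weights p d) :
    0 ≤ logisticRisk σ a x y W :=
  mul_nonneg (by positivity) (Finset.sum_nonneg fun i _ =>
    Real.log_nonneg (le_add_of_nonneg_right (Real.exp_pos _).le))

theorem norm_sampleDeriv_le {p d : ℕ} {σ : ℝ → ℝ} {M : ℝ} (hM : ∀ z, |deriv σ z| ≤ M)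
    (a : EuclideanSpace ℝ (Fin p)) (x : EuclideanSpace ℝ (Fin d)) {y : ℝ} (hy : |y| = 1)
    (W : Weights p d) : ‖sampleDeriv σ a x y W‖ ≤ ‖a‖ * M * ‖x‖ := by
  rw [sampleDeriv, norm_smul, norm_smul, norm_neg, Real.norm_eq_abs y, hy, one_mul,
    Real.norm_of_nonneg (Real.sigmoid_nonneg _)]
  exact (mul_le_of_le_one_left (norm_nonneg _) (Real.sigmoid_le_one _)).trans
    (norm_netDeriv_le hM a W x)

/-- Product rule: either the sigmoid varies, at rate `1 / 4` times that of the net, or the net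
derivative does. The sigmoid bound `κ` stays a parameter: `1` serves for the Villani property, a
bound depending on `‖a‖` and the bound on `σ` for the explicit constant. -/
theorem norm_sampleDeriv_sub_le {p d : ℕ} {σ : ℝ → ℝ} (hσ : Differentiable ℝ σ) {M M' κ : ℝ}
    (hM : ∀ z, |deriv σ z| ≤ M) (hM'0 : 0 ≤ M')
    (hM' : ∀ z w, |deriv σ z - deriv σ w| ≤ M' * |z - w|)
    (a : EuclideanSpace ℝ (Fin p)) (x : EuclideanSpace ℝ (Fin d)) {y : ℝ} (hy : |y| = 1)
    (hκ : ∀ W : Weights p d, Real.sigmoid (-y * net σ a W x) ≤ κ) (W W' : Weights p d) :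
    ‖sampleDeriv σ a x y W - sampleDeriv σ a x y W'‖ ≤
      (‖a‖ ^ 2 * M ^ 2 * ‖x‖ ^ 2 / 4 + κ * (‖a‖ * M' * ‖x‖ ^ 2)) * ‖W - W'‖ := by
  have hM0 : 0 ≤ M := (abs_nonneg _).trans (hM 0)
  have hκ0 : 0 ≤ κ := (Real.sigmoid_nonneg _).trans (hκ 0)
  set z := -y * net σ a W x with hz
  set z' := -y * net σ a W' x with hz'
  have h : sampleDeriv σ a x y W - sampleDeriv σ a x y W' =
      (Real.sigmoid z - Real.sigmoid z') • (-y) • netDeriv σ a W x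
        + Real.sigmoid z' • (-y) • (netDeriv σ a W x - netDeriv σ a W' x) := by
    rw [sampleDeriv, sampleDeriv, ← hz, ← hz']
    module
  have h1 : |Real.sigmoid z - Real.sigmoid z'| ≤ 1 / 4 * (‖a‖ * M * ‖x‖ * ‖W - W'‖) := by
    refine (abs_sigmoid_sub_le z z').trans ?_
    rw [hz, hz', ← mul_sub, abs_mul, abs_neg, hy, one_mul]
    gcongr
    exact abs_net_sub_le hσ hM a W W' x
  rw [h]
  refine (norm_add_le _ _).trans ?_
  simp only [norm_smul, norm_neg, Real.norm_eq_abs, hy, one_mul,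
    abs_of_nonneg (Real.sigmoid_nonneg z')]
  calc |Real.sigmoid z - Real.sigmoid z'| * ‖netDeriv σ a W x‖
        + Real.sigmoid z' * ‖netDeriv σ a W x - netDeriv σ a W' x‖
      ≤ 1 / 4 * (‖a‖ * M * ‖x‖ * ‖W - W'‖) * (‖a‖ * M * ‖x‖)
        + κ * (‖a‖ * M' * ‖x‖ ^ 2 * ‖W - W'‖) := by
        gcongr
        exacts [norm_netDeriv_le hM a W x, hκ W', norm_netDeriv_sub_le hM'0 hM' a W W' x]
    _ = _ := by ring

/-- The absolute value of `B` covers the empty sample, where nothing forces `B` to be nonnegative.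
-/
theorem norm_fderiv_logisticRisk_le {n p d : ℕ} {σ : ℝ → ℝ} (hσ : Differentiable ℝ σ) {M B : ℝ}
    (hM : ∀ z, |deriv σ z| ≤ M) (a : EuclideanSpace ℝ (Fin p))
    {x : Fin n → EuclideanSpace ℝ (Fin d)} (hx : ∀ i, ‖x i‖ ≤ B) {y : Fin n → ℝ}
    (hy : ∀ i, |y i| = 1) (W : Weights p d) :
    ‖fderiv ℝ (logisticRisk σ a x y) W‖ ≤ ‖a‖ * M * |B| := by
  have hM0 : 0 ≤ M := (abs_nonneg _).trans (hM 0)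
  rw [(hasFDerivAt_logisticRisk hσ a x y W).fderiv]
  refine norm_average_le (by positivity) fun i => (norm_sampleDeriv_le hM a (x i) (hy i) W).trans ?_
  have := (hx i).trans (le_abs_self B)
  gcongr

theorem norm_fderiv_logisticRisk_sub_le {n p d : ℕ} {σ : ℝ → ℝ} (hσ : Differentiable ℝ σ)
    {M M' B κ : ℝ} (hM : ∀ z, |deriv σ z| ≤ M) (hM'0 : 0 ≤ M')
    (hM' : ∀ z w, |deriv σ z - deriv σ w| ≤ M' * |z - w|) (a : EuclideanSpace ℝ (Fin p))
    {x : Fin n → EuclideanSpace ℝ (Fin d)} (hx : ∀ i, ‖x i‖ ≤ B) {y : Fin n → ℝ}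
    (hy : ∀ i, |y i| = 1) (hκ0 : 0 ≤ κ)
    (hκ : ∀ i (W : Weights p d), Real.sigmoid (-(y i) * net σ a W (x i)) ≤ κ)
    (W W' : Weights p d) :
    ‖fderiv ℝ (logisticRisk σ a x y) W - fderiv ℝ (logisticRisk σ a x y) W'‖ ≤
      (‖a‖ ^ 2 * M ^ 2 * B ^ 2 / 4 + κ * (‖a‖ * M' * B ^ 2)) * ‖W - W'‖ := by
  rw [(hasFDerivAt_logisticRisk hσ a x y W).fderiv, (hasFDerivAt_logisticRisk hσ a x y W').fderiv,
    ← smul_sub, ← Finset.sum_sub_distrib]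
  refine norm_average_le (by positivity) fun i =>
    (norm_sampleDeriv_sub_le hσ hM hM'0 hM' a (x i) (hy i) (hκ i) W W').trans ?_
  have := hx i
  gcongr

theorem contDiff_logisticRisk {n p d : ℕ} {σ : ℝ → ℝ} (hσ : ContDiff ℝ ∞ σ)
    (a : EuclideanSpace ℝ (Fin p)) (x : Fin n → EuclideanSpace ℝ (Fin d)) (y : Fin n → ℝ) :
    ContDiff ℝ ∞ (logisticRisk (p := p) σ a x y) := by
  refine contDiff_const.mul (ContDiff.sum fun i _ => ContDiff.log ?_ fun W => by positivity)
  exact contDiff_const.add (contDiff_const.mul (contDiff_net hσ a (x i))).exp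

theorem logisticLoss_eq {n p d : ℕ} (σ : ℝ → ℝ) (a : EuclideanSpace ℝ (Fin p))
    (x : Fin n → EuclideanSpace ℝ (Fin d)) (y : Fin n → ℝ) (lam : ℝ) :
    logisticLoss (p := p) σ a x y lam = fun W => logisticRisk σ a x y W + lam / 2 * ‖W‖ ^ 2 :=
  rfl

/-! ### Quadratic regularization -/

theorem hasFDerivAt_add_sq_norm {F : Type*} [NormedAddCommGroup F] [InnerProductSpace ℝ F]
    {g : F → ℝ} {g' : F →L[ℝ] ℝ} {x : F} (hg : HasFDerivAt g g' x) (lam : ℝ) :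
    HasFDerivAt (fun x => g x + lam / 2 * ‖x‖ ^ 2) (g' + lam • innerSL ℝ x) x := by
  have h1 : HasFDerivAt (fun x : F => ‖x‖ ^ 2) (2 • (innerSL ℝ x)) x :=
    (hasStrictFDerivAt_norm_sq x).hasFDerivAt
  convert! hg.add (h1.const_mul (lam / 2)) using 1
  ext v
  simp
  ring

theorem norm_fderiv_add_sq_norm_sub_le {F : Type*} [NormedAddCommGroup F] [InnerProductSpace ℝ F]
    {g : F → ℝ} (hg : Differentiable ℝ g) {K lam : ℝ} (hlam : 0 ≤ lam)
    (hK : ∀ x y, ‖fderiv ℝ g x - fderiv ℝ g y‖ ≤ K * ‖x - y‖) (x y : F) :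
    ‖fderiv ℝ (fun x => g x + lam / 2 * ‖x‖ ^ 2) x - fderiv ℝ (fun x => g x + lam / 2 * ‖x‖ ^ 2) y‖
      ≤ (K + lam) * ‖x - y‖ := by
  rw [(hasFDerivAt_add_sq_norm (hg x).hasFDerivAt lam).fderiv,
    (hasFDerivAt_add_sq_norm (hg y).hasFDerivAt lam).fderiv, add_sub_add_comm, ← smul_sub,
    ← map_sub, add_mul]
  refine norm_add_le_of_le (hK x y) ?_
  rw [norm_smul, innerSL_apply_norm, Real.norm_of_nonneg hlam]

theorem le_norm_fderiv_add_sq_norm {F : Type*} [NormedAddCommGroup F] [InnerProductSpace ℝ F]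
    {g : F → ℝ} (hg : Differentiable ℝ g) {K lam : ℝ} (hlam : 0 ≤ lam)
    (hK : ∀ x, ‖fderiv ℝ g x‖ ≤ K) (x : F) :
    lam * ‖x‖ - K ≤ ‖fderiv ℝ (fun x => g x + lam / 2 * ‖x‖ ^ 2) x‖ := by
  rw [(hasFDerivAt_add_sq_norm (hg x).hasFDerivAt lam).fderiv]
  have h1 := norm_sub_le (fderiv ℝ g x + lam • innerSL ℝ x) (fderiv ℝ g x)
  rw [add_sub_cancel_left, norm_smul, innerSL_apply_norm, Real.norm_of_nonneg hlam] at h1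
  linarith [hK x]

-- The Laplacian is a trace of the second derivative, whose norm is at most the Lipschitz constant
-- of the first; each unit basis vector contributes at most `K`.
open Module in
theorem laplacian_le_of_lipschitz_fderiv {F : Type*} [NormedAddCommGroup F]
    [InnerProductSpace ℝ F] [FiniteDimensional ℝ F] {f : F → ℝ} {K : ℝ} (hK0 : 0 ≤ K)
    (hK : ∀ x y, ‖fderiv ℝ f x - fderiv ℝ f y‖ ≤ K * ‖x - y‖) (x : F) :
    Laplacian.laplacian f x ≤ finrank ℝ F * K := by
  rw [InnerProductSpace.laplacian_eq_iteratedFDeriv_stdOrthonormalBasis]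
  have h : ‖fderiv ℝ (fderiv ℝ f) x‖ ≤ K :=
    norm_fderiv_le_of_lip' ℝ hK0 (Eventually.of_forall fun y => hK y x)
  calc ∑ i, iteratedFDeriv ℝ 2 f x ![stdOrthonormalBasis ℝ F i, stdOrthonormalBasis ℝ F i]
      ≤ ∑ _i : Fin (finrank ℝ F), K := by
        refine Finset.sum_le_sum fun i _ => ?_
        rw [iteratedFDeriv_two_apply]
        refine (le_abs_self _).trans ?_
        have hb : ‖stdOrthonormalBasis ℝ F i‖ = 1 := (stdOrthonormalBasis ℝ F).orthonormal.1 i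
        simpa [hb] using ((fderiv ℝ (fderiv ℝ f) x).le_opNorm₂ (stdOrthonormalBasis ℝ F i)
          (stdOrthonormalBasis ℝ F i)).trans (by simpa [hb] using h)
    _ = _ := by simp

/-- A nonnegative smooth function with bounded and Lipschitz derivative, plus a positive multiple
of the squared norm, is a Villani function. -/
theorem isVillani_add_sq_norm {ι : Type*} [Fintype ι] {g : EuclideanSpace ℝ ι → ℝ}
    (hg : ContDiff ℝ ∞ g) (hg0 : ∀ x, 0 ≤ g x) {C K : ℝ} (hC : ∀ x, ‖fderiv ℝ g x‖ ≤ C)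
    (hK0 : 0 ≤ K) (hK : ∀ x y, ‖fderiv ℝ g x - fderiv ℝ g y‖ ≤ K * ‖x - y‖)
    {lam : ℝ} (hlam : 0 < lam) : IsVillani fun x => g x + lam / 2 * ‖x‖ ^ 2 := by
  have hgd : Differentiable ℝ g := hg.differentiable (by simp)
  have hnorm : Tendsto (fun x : EuclideanSpace ℝ ι => ‖x‖) (Bornology.cobounded _) atTop :=
    tendsto_norm_cobounded_atTop
  refine ⟨⟨hg.add (contDiff_const.mul (contDiff_norm_sq ℝ)), ?_, fun s hs => ?_⟩, fun s hs => ?_⟩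
  · refine tendsto_atTop_mono (fun x => le_add_of_nonneg_left (hg0 x)) ?_
    exact ((tendsto_pow_atTop two_ne_zero).comp hnorm).const_mul_atTop (half_pos hlam)
  · obtain ⟨_, -, h⟩ := exists_gibbsPoincare_quadratic_add hgd hg0 hC hlam hs
    exact h.integrable
  · have h1 : Tendsto (fun x : EuclideanSpace ℝ ι => lam * ‖x‖ - C) (Bornology.cobounded _) atTop :=
      tendsto_atTop_add_const_right _ (-C) (hnorm.const_mul_atTop hlam)
    have h2 := ((tendsto_pow_atTop two_ne_zero).comp h1).const_mul_atTop
      (show 0 < 1 / s by positivity)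
    refine tendsto_atTop_mono' _ ?_ (tendsto_atTop_add_const_left _
      (-(Module.finrank ℝ (EuclideanSpace ℝ ι) * (K + lam))) h2)
    -- Squaring the lower bound on the gradient is legitimate only where that bound is nonnegative,
    -- hence far from the origin.
    filter_upwards [h1.eventually_ge_atTop 0] with x hx
    have h3 := laplacian_le_of_lipschitz_fderiv (by positivity)
      (norm_fderiv_add_sq_norm_sub_le hgd hlam.le hK) x
    have h4 := le_norm_fderiv_add_sq_norm hgd hlam.le hC x
    rw [norm_gradient_eq]
    refine add_le_add (neg_le_neg h3) ?_
    simp only [Function.comp]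
    gcongr

theorem isGradLipschitz_of_norm_fderiv_sub_le {ι : Type*} [Fintype ι]
    {f : EuclideanSpace ℝ ι → ℝ} (hf : Differentiable ℝ f) {K : ℝ≥0}
    (hK : ∀ x y, ‖fderiv ℝ f x - fderiv ℝ f y‖ ≤ K * ‖x - y‖) : IsGradLipschitz K f := by
  refine ⟨hf, LipschitzWith.of_dist_le_mul fun x y => ?_⟩
  rw [dist_eq_norm, dist_eq_norm, gradient, gradient, ← map_sub, LinearIsometryEquiv.norm_map]
  exact hK x y

theorem abs_deriv_sub_le_of_iteratedDeriv_two_le {σ : ℝ → ℝ} (hσ : ContDiff ℝ ∞ σ) {M : ℝ}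
    (hM : ∀ z, |iteratedDeriv 2 σ z| ≤ M) (z w : ℝ) :
    |deriv σ z - deriv σ w| ≤ M * |z - w| := by
  have hd : Differentiable ℝ (deriv σ) := by
    have := hσ.differentiable_iteratedDeriv 1 (by exact_mod_cast ENat.natCast_lt_top 1)
    rwa [iteratedDeriv_one] at this
  refine Convex.norm_image_sub_le_of_norm_deriv_le (s := Set.univ) (fun t _ => hd t) (fun t _ => ?_)
    convex_univ (Set.mem_univ _) (Set.mem_univ _)
  have h : deriv (deriv σ) = iteratedDeriv 2 σ := by rw [iteratedDeriv_succ, iteratedDeriv_one]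
  rw [h]
  exact hM t

/-! ### Assembly for the regularized logistic loss. -/

theorem lemma1 {n p d : ℕ} (hp : 0 < p)
    (σ : ℝ → ℝ) (hσ : Differentiable ℝ σ)
    (L : ℝ≥0) (hL : LipschitzWith L σ)
    (M_D : ℝ) (hM : ∀ z, |deriv σ z| ≤ M_D)
    (a : EuclideanSpace ℝ (Fin p))
    (x : Fin n → EuclideanSpace ℝ (Fin d)) (y : Fin n → ℝ)
    (hy : ∀ i, y i = 1 ∨ y i = -1)
    (B_x : ℝ) (hx : ∀ i, ‖x i‖ ≤ B_x) :
    -- the Gibbs measure satisfies a Poincaré-type inequality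
    (∀ lam : ℝ, criticalLambda M_D L B_x a < lam → ∀ s : ℝ, 0 < s →
      ∃ lam_s : ℝ, 0 < lam_s ∧ GibbsPoincare (logisticLoss σ a x y lam) s lam_s) ∧
    -- smooth activations with bounded second derivative: the loss is a Villani function
    (∀ M_D' : ℝ, ContDiff ℝ ∞ σ → (∀ z, |iteratedDeriv 2 σ z| ≤ M_D') →
      ∀ lam : ℝ, criticalLambda M_D L B_x a < lam → IsVillani (logisticLoss σ a x y lam)) ∧
    -- if the activation is moreover bounded: the loss is gradient-Lipschitz
    (∀ M_D' B_σ : ℝ, ContDiff ℝ ∞ σ → (∀ z, |iteratedDeriv 2 σ z| ≤ M_D') →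
      (∀ z, |σ z| ≤ B_σ) → ∀ lam : ℝ, 0 < lam →
      ∃ gLip : ℝ≥0, 0 < gLip ∧ IsGradLipschitz gLip (logisticLoss σ a x y lam) ∧
        (gLip : ℝ) ≤ √p * (√p * ‖a‖ ^ 2 * M_D ^ 2 * B_x ^ 2 / 4
          + (2 + ‖activationAtZero σ p‖ + ‖a‖ * B_σ) / 4 * M_D' * B_x ^ 2 * ‖a‖ * p + lam)) := by

  have hM0 : 0 ≤ M_D := (abs_nonneg _).trans (hM 0)
  have hy1 : ∀ i, |y i| = 1 := fun i => by rcases hy i with h | h <;> simp [h]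
  have hpos : ∀ lam, criticalLambda M_D L B_x a < lam → 0 < lam := fun lam h =>
    lt_of_le_of_lt (by rw [criticalLambda]; positivity) h
  have hdiff : Differentiable ℝ (logisticRisk (p := p) σ a x y) := fun W =>
    (hasFDerivAt_logisticRisk hσ a x y W).differentiableAt
  have hbd := norm_fderiv_logisticRisk_le (p := p) hσ hM a hx hy1
  simp only [logisticLoss_eq]
  refine ⟨fun lam hlam s hs => ?_, fun M' hσs hM' lam hlam => ?_,
    fun M' B hσs hM' hB lam hlam => ?_⟩
  · exact exists_gibbsPoincare_quadratic_add hdiff (logisticRisk_nonneg σ a x y) hbd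
      (hpos lam hlam) hs
  · have hM'0 : 0 ≤ M' := (abs_nonneg _).trans (hM' 0)
    exact isVillani_add_sq_norm (contDiff_logisticRisk hσs a x y) (logisticRisk_nonneg σ a x y) hbd
      (by positivity) (norm_fderiv_logisticRisk_sub_le hσ hM hM'0
        (abs_deriv_sub_le_of_iteratedDeriv_two_le hσs hM') a hx hy1 zero_le_one
        fun i W => Real.sigmoid_le_one _) (hpos lam hlam)
  · have hM'0 : 0 ≤ M' := (abs_nonneg _).trans (hM' 0)
    have hB0 : 0 ≤ B := (abs_nonneg _).trans (hB 0)
    -- Bound on the sigmoid factor, from `sigmoid_le_two_add_abs_div` and `abs_net_le`.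
    set κ : ℝ := (2 + √p * (‖a‖ * B)) / 4 with hκ
    have hlip := norm_fderiv_add_sq_norm_sub_le hdiff hlam.le
      (norm_fderiv_logisticRisk_sub_le hσ hM hM'0
        (abs_deriv_sub_le_of_iteratedDeriv_two_le hσs hM') a hx hy1
        (κ := κ) (by positivity) fun i W => by
          refine (sigmoid_le_two_add_abs_div _).trans ?_
          rw [abs_mul, abs_neg, hy1, one_mul, hκ]
          gcongr
          exact abs_net_le hB a W (x i))
    set K : ℝ := ‖a‖ ^ 2 * M_D ^ 2 * B_x ^ 2 / 4 + κ * (‖a‖ * M' * B_x ^ 2) + lam with hKdef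
    have hK : 0 < K := by positivity
    refine ⟨⟨K, hK.le⟩, hK, isGradLipschitz_of_norm_fderiv_sub_le (fun W =>
      (hasFDerivAt_add_sq_norm (hdiff W).hasFDerivAt lam).differentiableAt) hlip, ?_⟩
    -- The constant `K` is smaller than required. Since `p ≥ 1`, each factor `√p` only enlarges the
    -- target, `√p ≤ p` lets `κ` fit under the factor `p`, and the term `‖activationAtZero σ p‖` is
    -- nonnegative slack.
    have hp1 : (1 : ℝ) ≤ p := by exact_mod_cast hp
    have hs1 : 1 ≤ √(p : ℝ) := Real.one_le_sqrt.2 hp1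
    have hsp : √(p : ℝ) ≤ p := Real.sqrt_le_left (by positivity) |>.2 (by nlinarith)
    have hκle : κ ≤ (2 + ‖activationAtZero σ p‖ + ‖a‖ * B) / 4 * p := by
      have h1 : √(p : ℝ) * (‖a‖ * B) ≤ p * (‖a‖ * B) := by gcongr
      have h2 : 0 ≤ ‖activationAtZero σ p‖ * p := by positivity
      rw [hκ]
      linarith
    have h1 : ‖a‖ ^ 2 * M_D ^ 2 * B_x ^ 2 / 4 ≤ √p * ‖a‖ ^ 2 * M_D ^ 2 * B_x ^ 2 / 4 := by
      have : 0 ≤ ‖a‖ ^ 2 * M_D ^ 2 * B_x ^ 2 / 4 := by positivity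
      linarith [le_mul_of_one_le_left this hs1]
    have h2 : κ * (‖a‖ * M' * B_x ^ 2) ≤
        (2 + ‖activationAtZero σ p‖ + ‖a‖ * B) / 4 * M' * B_x ^ 2 * ‖a‖ * p := by
      linarith [mul_le_mul_of_nonneg_right hκle
        (show 0 ≤ ‖a‖ * M' * B_x ^ 2 by positivity)]
    have h3 : K ≤ √p * ‖a‖ ^ 2 * M_D ^ 2 * B_x ^ 2 / 4
        + (2 + ‖activationAtZero σ p‖ + ‖a‖ * B) / 4 * M' * B_x ^ 2 * ‖a‖ * p + lam := by
      rw [hKdef]; gcongr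
    exact h3.trans (le_mul_of_one_le_left (hK.le.trans h3) hs1)
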